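/- **Optimality condition.** Consider a directed rooted tree network with origins $\mathcal N=\{1,\dots,N\}$ and a single destination (the root). Link $i$ joins origin $i$ to its parent and has capacity $\mu_i\ge 0$ and free-flow travel time $d_i\ge 0$; origin $i$ has demand $Q_i\ge 0$. Let $\underline{\mathcal N}(i)$ be the set consisting of $i$ and the origins downstream of $i$, let $\overline{\mathcal N}(i)$ be the set consisting of $i$ and the origins upstream of $i$, and assume $\sum_{j:\,\mathrm{parent}(j)=i}\mu_j\le\mu_i$ for every $i\in\mathcal N$. Let $\mathcal T=[a,b]$, $a<b$, be the assignment period and $c:\mathcal T\to\mathbb R_+$ a bounded measurable schedule delay cost function of the arrival time at the destination. The problem [DSO] is to minimize $$f(q,w)=\sum_{i\in\mathcal N}\int_{\mathcal T}\Bigl(c(t)+\sum_{j\in\underline{\mathcal N}(i)}(w_j(t)+d_j)\Bigr)q_i(t)\,dt$$ over integrable inflow rates $q_i:\mathcal T\to\mathbb R$ and absolutely continuous queueing delays $w_i:\mathcal T\to[0,\infty)$ with $w_i(a)=0$ (no queue at the start of the period), subject to, for all $i\in\mathcal N$ and almost every $t\in\mathcal T$, $$\sum_{j\in\overline{\mathcal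 N}(i)}q_j(t)\;\begin{cases}=\mu_i\dot\sigma_i(t)&\text{if }w_i(t)>0,\\ \le\mu_i\dot\sigma_i(t)&\text{if }w_i(t)=0,\end{cases}\qquad \int_{\mathcal T}q_i(t)\,dt=Q_i,\qquad q_i(t)\ge0,\qquad \sum_{j\in\underline{\mathcal N}(i)}\dot w_j(t)<1,$$ where $\dot\sigma_i(t)=1-\sum_{j\in\underline{\mathcal N}(i)\setminus\{i\}}\dot w_j(t)$. If $(q^*,w^*)$ is an optimal solution of [DSO], then there are real numbers $\rho_i^*$ and integrable functions $p_i^*:\mathcal T\to[0,\infty)$, $i\in\mathcal N$ (the multipliers of the demand conservation condition and of the capacity constraint $\sum_{j\in\overline{\mathcal N}(i)}q_j(t)\le\mu_i$), such that for all $i\in\mathcal N$ and almost every $t\in\mathcal T$ $$\int_{\mathcal T}q_i^*(t)\,dt=Q_i,$$ $$\sum_{j\in\underline{\mathcal N}(i)}\bigl(p_j^*(t)+d_j\bigr)+c(t)\;\begin{cases}=\rho_i^*&\text{if }q_i^*(t)>0,\\ \ge\rho_i^*&\text{if }q_i^*(t)=0,\end{cases}$$ $$\sum_{j\in\overline{\mathcal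 N}(i)}q_j^*(t)\;\begin{cases}=\mu_i&\text{if }p_i^*(t)>0,\\ \le\mu_i&\text{if }p_i^*(t)=0.\end{cases}$$ -/

import Mathlib

open MeasureTheory Set

/-- A directed rooted tree network with a many-to-one origin-destination pattern, together with
the data of the assignment problem. The origins are the elements of `Fin N`; link `i` joins
origin `i` to its parent node, where `none` is the destination (the root).
The assignment period is the interval `[a, b]`. -/
structure TreeNetwork (N : ℕ) where
  /-- the parent node of an origin; `none` is the destination -/
  parent : Fin N → Option (Fin N)
  /-- every origin is connected to the destination by the chain of its parents -/
  rooted : ∀ i, ∃ k : ℕ, (fun v : Option (Fin N) => v.bind parent)^[k] (some i) = none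
  /-- bottleneck capacity of link `i` -/
  μ : Fin N → ℝ
  μ_nonneg : ∀ i, 0 ≤ μ i
  /-- the total capacity of the links that enter node `i` is at most the capacity of link `i` -/
  capacity_le : ∀ i, ∑ j with parent j = some i, μ j ≤ μ i
  /-- free-flow travel time of link `i` -/
  d : Fin N → ℝ
  d_nonneg : ∀ i, 0 ≤ d i
  /-- travel demand of origin `i` -/
  Q : Fin N → ℝ
  Q_nonneg : ∀ i, 0 ≤ Q i
  /-- start of the assignment period -/
  a : ℝ
  /-- end of the assignment period -/
  b : ℝ
  a_lt_b : a < b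
  /-- schedule delay cost, as a function of the arrival time at the destination -/
  c : ℝ → ℝ
  c_nonneg : ∀ t ∈ Icc a b, 0 ≤ c t
  c_measurable : AEMeasurable c (volume.restrict (Icc a b))
  c_bounded : BddAbove (c '' Icc a b)

namespace TreeNetwork

variable {N : ℕ} (G : TreeNetwork N)

/-- The assignment period. -/
def period : Set ℝ := Icc G.a G.b

/-- `G.Leads i j`: the path from origin `i` to the destination goes through `j`
(this includes `j = i`). -/
def Leads (i j : Fin N) : Prop :=
  Relation.ReflTransGen (fun k l => G.parent k = some l) i j

open Classical in
/-- Origin `i` and the origins downstream of it. -/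
noncomputable def down (i : Fin N) : Finset (Fin N) := {j | G.Leads i j}

open Classical in
/-- Origin `i` and the origins upstream of it. -/
noncomputable def up (i : Fin N) : Finset (Fin N) := {j | G.Leads j i}

/-- The derivative of the bottleneck departure time
`σ i t = t - ∑ j ∈ down i \ {i}, (w j t + d j)`
with respect to the destination arrival time `t`. -/
noncomputable def sigmaDot (w : Fin N → ℝ → ℝ) (i : Fin N) (t : ℝ) : ℝ :=
  1 - ∑ j ∈ (G.down i).erase i, deriv (w j) t

/-- Total system cost: schedule delay, queueing delay and free-flow travel costs. -/
noncomputable def cost (q w : Fin N → ℝ → ℝ) : ℝ :=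
  ∑ i, ∫ t in G.period, (G.c t + ∑ j ∈ G.down i, (w j t + G.d j)) * q i t

/-- Feasibility for the dynamic system optimal assignment problem. The variables are the inflow
rates `q i t` and the queueing delays `w i t`, as functions of the destination arrival time `t`.
Conditions on flow rates and derivatives are meant for almost every `t`. -/
structure IsFeasible (q w : Fin N → ℝ → ℝ) : Prop where
  q_integrable : ∀ i, IntegrableOn (q i) G.period
  w_absCont : ∀ i, AbsolutelyContinuousOnInterval (w i) G.a G.b
  w_nonneg : ∀ i, ∀ t ∈ G.period, 0 ≤ w i t
  /-- there is no queue at the start of the assignment period -/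
  w_start : ∀ i, w i G.a = 0
  queue_pos : ∀ i, ∀ᵐ t ∂volume.restrict G.period,
    0 < w i t → ∑ j ∈ G.up i, q j t = G.μ i * G.sigmaDot w i t
  queue_zero : ∀ i, ∀ᵐ t ∂volume.restrict G.period,
    w i t = 0 → ∑ j ∈ G.up i, q j t ≤ G.μ i * G.sigmaDot w i t
  demand : ∀ i, ∫ t in G.period, q i t = G.Q i
  q_nonneg : ∀ i, ∀ᵐ t ∂volume.restrict G.period, 0 ≤ q i t
  /-- the bottleneck arrival times are increasing in the destination arrival time -/
  w_deriv : ∀ i, ∀ᵐ t ∂volume.restrict G.period, ∑ j ∈ G.down i, deriv (w j) t < 1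

/-- `(q, w)` is a (globally) optimal solution of the dynamic system optimal problem. -/
def IsOptimal (q w : Fin N → ℝ → ℝ) : Prop :=
  G.IsFeasible q w ∧ ∀ q' w', G.IsFeasible q' w' → G.cost q w ≤ G.cost q' w'

/-- The optimality conditions for the flow pattern `q`, the multipliers `ρ` of demand conservation
and the multipliers `p` of the capacity constraints. -/
structure OptimalityConditions (q : Fin N → ℝ → ℝ) (ρ : Fin N → ℝ) (p : Fin N → ℝ → ℝ) :
    Prop where
  p_integrable : ∀ i, IntegrableOn (p i) G.period
  p_nonneg : ∀ i, ∀ t ∈ G.period, 0 ≤ p i t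
  demand : ∀ i, ∫ t in G.period, q i t = G.Q i
  cost_eq : ∀ i, ∀ᵐ t ∂volume.restrict G.period,
    0 < q i t → ∑ j ∈ G.down i, (p j t + G.d j) + G.c t = ρ i
  cost_ge : ∀ i, ∀ᵐ t ∂volume.restrict G.period,
    q i t = 0 → ρ i ≤ ∑ j ∈ G.down i, (p j t + G.d j) + G.c t
  capacity_eq : ∀ i, ∀ᵐ t ∂volume.restrict G.period,
    0 < p i t → ∑ j ∈ G.up i, q j t = G.μ i
  capacity_le : ∀ i, ∀ᵐ t ∂volume.restrict G.period,
    p i t = 0 → ∑ j ∈ G.up i, q j t ≤ G.μ i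

end TreeNetwork

/-!
The proof first removes the queues and then finds the multipliers of the remaining linear
program.

*Queues can be avoided.* Let `(q, w)` be feasible and let `X i` be the flow through link `i`. The
trips that arrive at the destination at time `t` leave bottleneck `i` at time `σ i t`, up to
free-flow times, where `σ i` is strictly increasing and absolutely continuous. Counting the trips
through link `i` by the time at which they leave the bottleneck gives the measure `outflow i`, the
image of `X i dt` under `σ i`. It is at most `μ i` times Lebesgue measure
(`IsFeasible.outflow_le`), and it dominates the sum of the outflows of the links that enter node
`i` (`IsFeasible.sum_outflow_le`): at times with a queue at `i` because `μ i` covers the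
capacities of the entering links, and at other times because no trip waits at `i`. Hence the
densities of the outflows are the link flows of inflow rates `q'` that respect the capacities
without queues. They serve the same demand, and they have the same total inflow rate at the
destination, hence the same schedule cost (`IsFeasible.exists_isAdmissible`). So in an optimal
solution queueing costs nothing. As a queue at a link of positive capacity discharges at a
positive rate, there is no such queue, and `q` minimizes the schedule cost under the capacity
constraints `X i ≤ μ i` (`IsOptimal.isScheduleOptimal`).

*Multipliers.* The pairs (demand change, change of schedule cost) that can be realized by
admissible perturbations of `q` form a convex cone. Let `r i` be the least marginal cost of an
additional trip from `i`. Shifting trips between origins and times on small sets of times shows that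
almost everywhere (`IsAdmissible.ae_le_of_isAttainable`)

* `c t ≤ r i` if `q i t > 0`,
* `r j ≤ r i` if `q i t > 0` and `j` is downstream of `i`,
* `r i ≤ r j` if `q j t > 0`, `j` is downstream of `i`, and the links from `i` to `j` are slack,
* `r i ≤ c t` if all links from `i` to the destination are slack.

The last two and `∑ μ ≤ μ i` over the links entering `i` yield that link `i` is saturated whenever
`c t < r i`, provided that `r j < r i` for all `j` downstream of `i`
(`IsScheduleOptimal.capacity_eq_of_price_lt`). So the multipliers are
`ρ i = r i + ∑ d j` over `j ∈ down i`, and `p i` is chosen such that the sum of `p` over `down i` is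
the maximum over `j ∈ down i` of the positive part of `r j - c t`.
-/

/-! ### Tree structure -/

namespace TreeNetwork

variable {N : ℕ} (G : TreeNetwork N)

@[simp] lemma mem_down {i j : Fin N} : j ∈ G.down i ↔ G.Leads i j := by simp [down]

@[simp] lemma mem_up {i j : Fin N} : j ∈ G.up i ↔ G.Leads j i := by simp [up]

lemma leads_refl (i : Fin N) : G.Leads i i := Relation.ReflTransGen.refl

variable {G}

lemma Leads.trans {i j k : Fin N} (h : G.Leads i j) (h' : G.Leads j k) : G.Leads i k :=
  Relation.ReflTransGen.trans h h'

lemma leads_of_parent {i j : Fin N} (h : G.parent i = some j) : G.Leads i j :=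
  Relation.ReflTransGen.single h

variable (G)

lemma wellFounded_parent : WellFounded fun j i : Fin N => G.parent i = some j := by
  have key : ∀ (k : ℕ) (i : Fin N),
      (fun v : Option (Fin N) => v.bind G.parent)^[k] (some i) = none →
      Acc (fun j i : Fin N => G.parent i = some j) i := by
    intro k
    induction k with
    | zero => intro i h; simp at h
    | succ k ih =>
      intro i h
      refine Acc.intro i fun j hj => ih j ?_
      simpa [Function.iterate_succ_apply, hj] using h
  exact ⟨fun i => let ⟨k, hk⟩ := G.rooted i; key k i hk⟩

lemma wellFounded_child : WellFounded fun c i : Fin N => G.parent c = some i := by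
  have hirr : Std.Irrefl (Relation.TransGen fun c i : Fin N => G.parent c = some i) := by
    refine ⟨fun i hi => ?_⟩
    have h := (Relation.transGen_swap (r := fun j i : Fin N => G.parent i = some j)).1 hi
    exact (G.wellFounded_parent.transGen).irrefl.irrefl i h
  have := Finite.wellFounded_of_trans_of_irrefl
    (Relation.TransGen fun c i : Fin N => G.parent c = some i)
  exact Subrelation.wf (r := Relation.TransGen fun c i : Fin N => G.parent c = some i)
    (fun h => Relation.TransGen.single h) this

variable {G}

lemma Leads.cases_parent {i j : Fin N} (h : G.Leads i j) (hij : i ≠ j) :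
    ∃ k, G.parent i = some k ∧ G.Leads k j := by
  rcases Relation.ReflTransGen.cases_head h with h | h
  · exact absurd h hij
  · exact h

lemma not_leads_of_parent {i j : Fin N} (h : G.parent i = some j) : ¬ G.Leads j i := by
  intro hji
  have h1 : Relation.TransGen (fun c i : Fin N => G.parent c = some i) i i :=
    Relation.TransGen.head' h hji
  exact (G.wellFounded_child.transGen).irrefl.irrefl i h1

lemma down_erase_of_parent {i j : Fin N} (h : G.parent i = some j) :
    (G.down i).erase i = G.down j := by
  ext k
  simp only [Finset.mem_erase, mem_down]
  constructor
  · rintro ⟨hk, hik⟩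
    obtain ⟨l, hl, hlk⟩ := hik.cases_parent (Ne.symm hk)
    rw [h] at hl
    cases hl
    exact hlk
  · intro hjk
    refine ⟨?_, (leads_of_parent h).trans hjk⟩
    rintro rfl
    exact not_leads_of_parent h hjk

lemma down_erase_of_root {i : Fin N} (h : G.parent i = none) : (G.down i).erase i = ∅ := by
  ext k
  simp only [Finset.mem_erase, mem_down, Finset.notMem_empty, iff_false, not_and]
  intro hk hik
  obtain ⟨l, hl, -⟩ := hik.cases_parent (Ne.symm hk)
  simp [h] at hl

lemma sum_up (i : Fin N) (g : Fin N → ℝ) :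
    ∑ j ∈ G.up i, g j = g i + ∑ c with G.parent c = some i, ∑ j ∈ G.up c, g j := by
  classical
  have hup : G.up i = insert i (({c | G.parent c = some i} : Finset (Fin N)).biUnion G.up) := by
    ext k
    simp only [mem_up, Finset.mem_insert, Finset.mem_biUnion, Finset.mem_filter,
      Finset.mem_univ, true_and]
    constructor
    · intro hk
      rcases Relation.ReflTransGen.cases_tail hk with h | ⟨c, hc, hci⟩
      · exact Or.inl h.symm
      · exact Or.inr ⟨c, hci, hc⟩
    · rintro (rfl | ⟨c, hc, hkc⟩)
      · exact G.leads_refl _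
      · exact Leads.trans hkc (leads_of_parent hc)
  have hdisj : ∀ c c' k : Fin N, G.parent c = some i → G.parent c' = some i → G.Leads k c →
      G.Leads k c' → c = c' := by
    intro c c' k hc hc' hkc hkc'
    rcases Relation.ReflTransGen.total_of_right_unique
      (r := fun k l => G.parent k = some l) (fun a b c hb hc => by simpa [hb] using hc)
      hkc hkc' with h | h
    · by_contra hne
      obtain ⟨l, hl, hlc⟩ := Leads.cases_parent h hne
      rw [hc] at hl
      cases hl
      exact not_leads_of_parent hc' hlc
    · by_contra hne
      obtain ⟨l, hl, hlc⟩ := Leads.cases_parent h (Ne.symm hne)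
      rw [hc'] at hl
      cases hl
      exact not_leads_of_parent hc hlc
  rw [hup, Finset.sum_insert, Finset.sum_biUnion]
  · intro c hc c' hc' hne
    simp only [Finset.coe_filter, Finset.mem_univ, true_and, mem_ofPred_eq] at hc hc'
    refine Finset.disjoint_left.2 fun k hk hk' => hne ?_
    exact hdisj c c' k hc hc' (by simpa using hk) (by simpa using hk')
  · simp only [Finset.mem_biUnion, Finset.mem_filter, Finset.mem_univ, true_and, mem_up, not_exists,
      not_and]
    exact fun c hc => not_leads_of_parent hc

/-- Net flows `f i - ∑ f c` at the nodes add up to the link flows `f`. -/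
lemma sum_up_net (f : Fin N → ℝ) (i : Fin N) :
    ∑ j ∈ G.up i, (f j - ∑ c with G.parent c = some j, f c) = f i := by
  induction i using G.wellFounded_child.induction with
  | _ i ih =>
    rw [sum_up, Finset.sum_congr rfl fun c hc => ih c (by simpa using hc)]
    ring

lemma sum_net (f : Fin N → ℝ) :
    ∑ i, (f i - ∑ c with G.parent c = some i, f c) = ∑ i with G.parent i = none, f i := by
  classical
  rw [Finset.sum_sub_distrib, sub_eq_iff_eq_add]
  rw [← Finset.sum_filter_add_sum_filter_not Finset.univ (fun i => G.parent i = none)]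
  congr 1
  simp_rw [Finset.sum_filter]
  rw [Finset.sum_comm]
  refine Finset.sum_congr rfl fun i _ => ?_
  cases h : G.parent i <;> simp

lemma sum_eq_sum_root (q : Fin N → ℝ) :
    ∑ i, q i = ∑ i with G.parent i = none, ∑ j ∈ G.up i, q j := by
  rw [← sum_net]
  refine Finset.sum_congr rfl fun i _ => ?_
  rw [sum_up i]
  ring

lemma sum_down_telescope (F : Finset (Fin N) → ℝ) (i : Fin N) :
    ∑ j ∈ G.down i, (F (G.down j) - F ((G.down j).erase j)) = F (G.down i) - F ∅ := by
  induction i using G.wellFounded_parent.induction with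
  | _ i ih =>
    have hi : i ∈ G.down i := by simpa using G.leads_refl i
    rw [← Finset.add_sum_erase _ _ hi]
    cases h : G.parent i with
    | none => simp [down_erase_of_root h]
    | some j =>
      rw [down_erase_of_parent h, ih j h]
      ring

lemma μ_le_of_leads {i j : Fin N} (h : G.Leads i j) : G.μ i ≤ G.μ j := by
  induction h with
  | refl => exact le_rfl
  | tail _ hk ih =>
    refine ih.trans (le_trans ?_ (G.capacity_le _))
    exact Finset.single_le_sum (f := G.μ) (fun c _ => G.μ_nonneg c) (by simpa using hk)

end TreeNetwork

/-! ### Schedule costs and marginal costs -/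

namespace TreeNetwork

variable {N : ℕ} {G : TreeNetwork N} {q : Fin N → ℝ → ℝ}

lemma measurableSet_period : MeasurableSet G.period := measurableSet_Icc

instance : IsFiniteMeasure (volume.restrict G.period) := by
  unfold period
  infer_instance

lemma ae_mem_period : ∀ᵐ t ∂volume.restrict G.period, t ∈ G.period :=
  ae_restrict_mem measurableSet_period

lemma exists_c_le (G : TreeNetwork N) : ∃ C, ∀ t ∈ G.period, G.c t ≤ C := by
  obtain ⟨C, hC⟩ := G.c_bounded
  exact ⟨C, fun t ht => hC ⟨t, ht, rfl⟩⟩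

lemma integrable_c : Integrable G.c (volume.restrict G.period) := by
  obtain ⟨C, hC⟩ := G.exists_c_le
  refine Integrable.of_bound G.c_measurable.aestronglyMeasurable C ?_
  filter_upwards [ae_mem_period] with t ht
  rw [Real.norm_of_nonneg (G.c_nonneg t ht)]
  exact hC t ht

lemma integrable_c_mul {f : ℝ → ℝ} (hf : IntegrableOn f G.period) :
    IntegrableOn (fun t => G.c t * f t) G.period := by
  obtain ⟨C, hC⟩ := G.exists_c_le
  refine Integrable.bdd_mul (c := C) hf G.c_measurable.aestronglyMeasurable ?_
  filter_upwards [ae_mem_period] with t ht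
  rw [Real.norm_of_nonneg (G.c_nonneg t ht)]
  exact hC t ht

variable (G) in
/-- Inflow rates that respect the bottleneck capacities without any queueing, regardless of the
demand. -/
structure IsAdmissible (q : Fin N → ℝ → ℝ) : Prop where
  integrable : ∀ i, IntegrableOn (q i) G.period
  nonneg : ∀ i, ∀ᵐ t ∂volume.restrict G.period, 0 ≤ q i t
  capacity : ∀ i, ∀ᵐ t ∂volume.restrict G.period, ∑ j ∈ G.up i, q j t ≤ G.μ i

variable (G) in
/-- Total schedule delay cost of the inflow rates `q`. -/
noncomputable def scheduleCost (q : Fin N → ℝ → ℝ) : ℝ :=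
  ∑ i, ∫ t in G.period, G.c t * q i t

variable (G q) in
/-- `G.IsAttainable q v z`: a positive multiple of the demand change `v` can be served by an
admissible flow, starting from `q`, at an additional schedule cost of `z` per unit. The pairs
`(v, z)` form a convex cone. -/
def IsAttainable (v : Fin N → ℝ) (z : ℝ) : Prop :=
  ∃ ε > 0, ∃ q', G.IsAdmissible q' ∧
    (∀ i, ∫ t in G.period, q' i t = (∫ t in G.period, q i t) + ε * v i) ∧
    G.scheduleCost q' = G.scheduleCost q + ε * z

lemma IsAdmissible.combine {q' : Fin N → ℝ → ℝ} (hq : G.IsAdmissible q) (hq' : G.IsAdmissible q')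
    {x y : ℝ} (hx : 0 ≤ x) (hy : 0 ≤ y) (hxy : x + y = 1) :
    G.IsAdmissible fun i t => x * q i t + y * q' i t where
  integrable i := ((hq.integrable i).const_mul x).add ((hq'.integrable i).const_mul y)
  nonneg i := by
    filter_upwards [hq.nonneg i, hq'.nonneg i] with t h h'
    positivity
  capacity i := by
    filter_upwards [hq.capacity i, hq'.capacity i] with t h h'
    rw [Finset.sum_add_distrib, ← Finset.mul_sum, ← Finset.mul_sum]
    calc _ ≤ x * G.μ i + y * G.μ i := by gcongr
      _ = G.μ i := by rw [← add_mul, hxy, one_mul]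

lemma IsAdmissible.integral_combine {q' : Fin N → ℝ → ℝ} (hq : G.IsAdmissible q)
    (hq' : G.IsAdmissible q') (x y : ℝ) (i : Fin N) :
    ∫ t in G.period, (x * q i t + y * q' i t) =
      x * (∫ t in G.period, q i t) + y * ∫ t in G.period, q' i t := by
  rw [integral_add ((hq.integrable i).const_mul x) ((hq'.integrable i).const_mul y),
    integral_const_mul, integral_const_mul]

lemma IsAdmissible.scheduleCost_combine {q' : Fin N → ℝ → ℝ} (hq : G.IsAdmissible q)
    (hq' : G.IsAdmissible q') (x y : ℝ) :
    G.scheduleCost (fun i t => x * q i t + y * q' i t) =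
      x * G.scheduleCost q + y * G.scheduleCost q' := by
  unfold scheduleCost
  rw [Finset.mul_sum, Finset.mul_sum, ← Finset.sum_add_distrib]
  refine Finset.sum_congr rfl fun i _ => ?_
  rw [← integral_const_mul, ← integral_const_mul, ← integral_add]
  · refine integral_congr_ae (ae_of_all _ fun t => ?_)
    ring
  · exact (integrable_c_mul (hq.integrable i)).const_mul x
  · exact (integrable_c_mul (hq'.integrable i)).const_mul y

lemma IsAttainable.add {v v' : Fin N → ℝ} {z z' : ℝ} (h : G.IsAttainable q v z)
    (h' : G.IsAttainable q v' z') : G.IsAttainable q (v + v') (z + z') := by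
  obtain ⟨ε, hε, r, hr, hv, hz⟩ := h
  obtain ⟨ε', hε', r', hr', hv', hz'⟩ := h'
  refine ⟨ε * ε' / (ε + ε'), by positivity, _,
    hr.combine hr' (x := ε' / (ε + ε')) (y := ε / (ε + ε')) (by positivity) (by positivity)
      (by field_simp; ring), fun i => ?_, ?_⟩
  · rw [hr.integral_combine hr', hv, hv', Pi.add_apply]
    field_simp
    ring
  · rw [hr.scheduleCost_combine hr', hz, hz']
    field_simp
    ring

/-- Optimality of `q` among the admissible flows with the same demand. -/
def IsScheduleOptimal (G : TreeNetwork N) (q : Fin N → ℝ → ℝ) : Prop :=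
  G.IsAdmissible q ∧ ∀ q', G.IsAdmissible q' →
    (∀ i, ∫ t in G.period, q' i t = ∫ t in G.period, q i t) →
    G.scheduleCost q ≤ G.scheduleCost q'

lemma IsScheduleOptimal.nonneg_of_isAttainable_zero (hq : G.IsScheduleOptimal q) {z : ℝ}
    (h : G.IsAttainable q 0 z) : 0 ≤ z := by
  obtain ⟨ε, hε, q', hq', hv, hz⟩ := h
  have := hq.2 q' hq' (fun i => by simpa using hv i)
  rw [hz] at this
  exact nonneg_of_mul_nonneg_right (by linarith) hε

/-- An additional unit of demand never saves cost: scaling the flow of that origin down again would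
give a flow with the original demand and no larger cost. -/
lemma IsScheduleOptimal.nonneg_of_isAttainable_single (hq : G.IsScheduleOptimal q) {i : Fin N}
    {z : ℝ} (h : G.IsAttainable q (Pi.single i 1) z) : 0 ≤ z := by
  obtain ⟨ε, hε, q', hq', hv, hz⟩ := h
  have hQ : 0 ≤ ∫ t in G.period, q i t := integral_nonneg_of_ae (hq.1.nonneg i)
  set x : ℝ := (∫ t in G.period, q i t) / ((∫ t in G.period, q i t) + ε) with hx
  have hx0 : 0 ≤ x := by positivity
  have hx1 : x ≤ 1 := by
    rw [hx, div_le_one (by positivity)]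
    linarith
  have hle : ∀ j, ∀ᵐ t ∂volume.restrict G.period,
      (if j = i then x else 1) * q' j t ≤ q' j t := by
    intro j
    filter_upwards [hq'.nonneg j] with t ht
    split_ifs
    · exact mul_le_of_le_one_left ht hx1
    · rw [one_mul]
  have hint : ∀ j, IntegrableOn (fun t => (if j = i then x else 1) * q' j t) G.period :=
    fun j => (hq'.integrable j).const_mul _
  have hadm : G.IsAdmissible fun j t => (if j = i then x else 1) * q' j t :=
    { integrable := hint
      nonneg := fun j => by
        filter_upwards [hq'.nonneg j] with t ht
        split_ifs <;> positivity
      capacity := fun j => by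
        filter_upwards [hq'.capacity j, ae_all_iff.2 hle] with t ht hle
        exact (Finset.sum_le_sum fun k _ => hle k).trans ht }
  have h1 := hq.2 _ hadm fun j => by
    rw [integral_const_mul, hv]
    by_cases hj : j = i
    · subst hj
      simp only [if_true, Pi.single_eq_same, mul_one, hx]
      field_simp
    · simp [hj]
  have h2 : G.scheduleCost (fun j t => (if j = i then x else 1) * q' j t) ≤
      G.scheduleCost q' := by
    refine Finset.sum_le_sum fun j _ => integral_mono_ae (integrable_c_mul (hint j))
      (integrable_c_mul (hq'.integrable j)) ?_
    filter_upwards [hle j, ae_mem_period] with t ht hmem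
    exact mul_le_mul_of_nonneg_left ht (G.c_nonneg t hmem)
  exact nonneg_of_mul_nonneg_right (by linarith) hε

variable (G q) in
/-- The price of a trip from origin `i`: the infimum of the marginal schedule costs of an
additional trip, truncated at `C` since there may be no way to serve an additional trip. -/
noncomputable def price (C : ℝ) (i : Fin N) : ℝ :=
  sInf (insert C {z | G.IsAttainable q (Pi.single i 1) z})

lemma IsScheduleOptimal.bddBelow (hq : G.IsScheduleOptimal q) (C : ℝ) (i : Fin N) :
    BddBelow (insert C {z | G.IsAttainable q (Pi.single i 1) z}) :=
  BddBelow.insert C ⟨0, fun _ hz => hq.nonneg_of_isAttainable_single hz⟩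

lemma IsScheduleOptimal.price_le (hq : G.IsScheduleOptimal q) (C : ℝ) {i : Fin N} {z : ℝ}
    (h : G.IsAttainable q (Pi.single i 1) z) : G.price q C i ≤ z :=
  csInf_le (hq.bddBelow C i) (mem_insert_of_mem _ h)

lemma IsScheduleOptimal.price_sub_price_le (hq : G.IsScheduleOptimal q) (C : ℝ) {i j : Fin N}
    {z : ℝ} (hz : 0 ≤ z) (h : G.IsAttainable q (Pi.single i 1 - Pi.single j 1) z) :
    G.price q C i - G.price q C j ≤ z := by
  rw [sub_le_iff_le_add, ← sub_le_iff_le_add']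
  refine le_csInf ⟨C, mem_insert _ _⟩ ?_
  rintro y (rfl | hy)
  · have : G.price q y i ≤ y := csInf_le (hq.bddBelow y i) (mem_insert _ _)
    linarith
  · have := hq.price_le C (i := i) (z := z + y) (by simpa using h.add hy)
    linarith

lemma IsScheduleOptimal.le_price (hq : G.IsScheduleOptimal q) {C : ℝ} {i : Fin N} {z : ℝ}
    (hzC : -z ≤ C) (h : G.IsAttainable q (-Pi.single i 1) z) : -z ≤ G.price q C i := by
  refine le_csInf ⟨C, mem_insert _ _⟩ ?_
  rintro y (rfl | hy)
  · exact hzC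
  · have := hq.nonneg_of_isAttainable_zero (z := z + y) (by simpa using h.add hy)
    linarith

/-- Shifting the inflow rates `q` by a small multiple of a vector `v` during a small set of
times. The schedule cost per unit is an average of `c` over these times. -/
lemma IsAdmissible.exists_isAttainable (hq : G.IsAdmissible q) (v : Fin N → ℝ) (u η : ℝ)
    (hη : 0 < η)
    (hs : ¬ ∀ᵐ t ∂volume.restrict G.period,
      (∀ i, 0 ≤ q i t + η * v i ∧ ∑ j ∈ G.up i, (q j t + η * v j) ≤ G.μ i) →
        u ≤ G.c t * ∑ i, v i) :
    ∃ z, z < u ∧ (∀ C, (∀ t ∈ G.period, G.c t ≤ C) → ∑ i, v i = -1 → -z ≤ C) ∧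
      (∑ i, v i = 0 → z = 0) ∧ G.IsAttainable q v z := by
  set ν := volume.restrict G.period with hν
  set V := ∑ i, v i with hV
  set s : Set ℝ := {t | (∀ i, 0 ≤ q i t + η * v i ∧ ∑ j ∈ G.up i, (q j t + η * v j) ≤ G.μ i) ∧
    G.c t * V < u} with hs_def
  have hqm : ∀ i, AEMeasurable (q i) ν := fun i => (hq.integrable i).aemeasurable
  have hsm : NullMeasurableSet s ν := by
    have h1 : ∀ i, NullMeasurableSet {t | 0 ≤ q i t + η * v i} ν := fun i =>
      nullMeasurableSet_le aemeasurable_const ((hqm i).add_const _)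
    have h2 : ∀ i, NullMeasurableSet {t | ∑ j ∈ G.up i, (q j t + η * v j) ≤ G.μ i} ν := fun i =>
      nullMeasurableSet_le (Finset.aemeasurable_fun_sum _ fun j _ => (hqm j).add_const _)
        aemeasurable_const
    have h3 : NullMeasurableSet {t | G.c t * V < u} ν :=
      nullMeasurableSet_lt (G.c_measurable.mul_const _) aemeasurable_const
    convert (NullMeasurableSet.iInter fun i => (h1 i).inter (h2 i)).inter h3 using 1
    ext t
    simp [hs_def]
  have hs0 : ν s ≠ 0 := by
    intro h0
    refine hs ?_
    rw [ae_iff]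
    convert h0 using 2
    ext t
    simp [hs_def]
  obtain ⟨A, hAs, hAm, hA⟩ := hsm.exists_measurable_subset_ae_eq
  have hA0 : ν A ≠ 0 := by rwa [measure_congr hA]
  have hAr : 0 < ν.real A := ENNReal.toReal_pos hA0 (measure_ne_top _ _)
  have hci : IntegrableOn G.c A ν := integrable_c.integrableOn
  have havg : ∀ k : ℝ, (∫ t in A, k ∂ν) = ν.real A * k := fun k => by simp
  set z : ℝ := (∫ t in A, G.c t ∂ν) / ν.real A * V with hz
  have hmem : ∀ᵐ t ∂ν.restrict A, t ∈ G.period := ae_restrict_of_ae ae_mem_period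
  refine ⟨z, ?_, ?_, fun h => by simp [hz, h], ?_⟩
  · have hpos : 0 < ∫ t in A, (u - G.c t * V) ∂ν := by
      rw [setIntegral_pos_iff_support_of_nonneg_ae]
      · refine lt_of_lt_of_le (pos_iff_ne_zero.2 hA0) (measure_mono fun t ht => ⟨?_, ht⟩)
        exact (sub_pos.2 (hAs ht).2).ne'
      · filter_upwards [ae_restrict_mem hAm] with t ht
        exact (sub_pos.2 (hAs ht).2).le
      · exact (integrable_const u).sub (hci.mul_const V)
    rw [integral_sub (integrable_const u) (hci.mul_const V), havg, integral_mul_const] at hpos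
    rw [hz, div_mul_eq_mul_div, div_lt_iff₀ hAr]
    linarith
  · intro C hC hV1
    have : ∫ t in A, G.c t ∂ν ≤ ∫ t in A, C ∂ν := by
      refine integral_mono_ae hci (integrable_const C) ?_
      filter_upwards [hmem] with t ht using hC t ht
    rw [havg] at this
    rw [hz, hV1, mul_neg_one, neg_neg, div_le_iff₀ hAr]
    linarith
  · have hind : ∀ i, Integrable (A.indicator fun _ => η * v i) ν := fun i =>
      (integrable_const _).indicator hAm
    refine ⟨η * ν.real A, by positivity, fun i t => q i t + A.indicator (fun _ => η * v i) t,
      ⟨fun i => (hq.integrable i).add (hind i), fun i => ?_, fun i => ?_⟩, fun i => ?_, ?_⟩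
    · filter_upwards [hq.nonneg i] with t ht
      by_cases hA : t ∈ A
      · simpa [hA] using ((hAs hA).1 i).1
      · simpa [hA] using ht
    · filter_upwards [hq.capacity i] with t ht
      by_cases hA : t ∈ A
      · simpa [hA] using ((hAs hA).1 i).2
      · simpa [hA] using ht
    · rw [integral_add (hq.integrable i) (hind i), integral_indicator hAm, havg]
      ring
    · have hi : ∀ i, ∫ t in G.period, G.c t * (q i t + A.indicator (fun _ => η * v i) t) =
          (∫ t in G.period, G.c t * q i t) + (∫ t in A, G.c t ∂ν) * (η * v i) := by
        intro i
        have : ∀ t, G.c t * (q i t + A.indicator (fun _ => η * v i) t) =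
            G.c t * q i t + A.indicator (fun t => G.c t * (η * v i)) t := by
          intro t
          by_cases hA : t ∈ A <;> simp [hA, mul_add]
        simp_rw [this]
        rw [integral_add (integrable_c_mul (hq.integrable i))
          ((integrable_c.mul_const _).indicator hAm), integral_indicator hAm, integral_mul_const]
      unfold scheduleCost
      rw [Finset.sum_congr rfl fun i _ => hi i, Finset.sum_add_distrib, ← Finset.mul_sum,
        ← Finset.mul_sum, ← hV, hz]
      field_simp

end TreeNetwork

/-! ### Multipliers of a flow with minimal schedule cost -/

namespace TreeNetwork

variable {N : ℕ} {G : TreeNetwork N} {q : Fin N → ℝ → ℝ}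

lemma eventually_nonneg_add_mul {x y : ℝ} (hx : 0 ≤ x) (h : y < 0 → 0 < x) :
    ∀ᶠ n : ℕ in Filter.atTop, 0 ≤ x + 1 / ((n : ℝ) + 1) * y := by
  rcases lt_or_ge y 0 with hy | hy
  · have : Filter.Tendsto (fun n : ℕ => x + 1 / ((n : ℝ) + 1) * y) Filter.atTop
        (nhds (x + 0 * y)) :=
      (tendsto_one_div_add_atTop_nhds_zero_nat.mul_const y).const_add x
    rw [zero_mul, add_zero] at this
    exact (this.eventually_const_lt (h hy)).mono fun _ h => h.le
  · exact Filter.Eventually.of_forall fun n => by positivity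

/-- A lower bound on the marginal schedule costs of the demand change `v` bounds the cost of
shifting `q` in direction `v` at almost every single time at which such a shift is possible. -/
lemma IsAdmissible.ae_le_of_isAttainable (hq : G.IsAdmissible q) (v : Fin N → ℝ) (u : ℝ)
    (h : ∀ z, (∀ C, (∀ t ∈ G.period, G.c t ≤ C) → ∑ i, v i = -1 → -z ≤ C) →
      (∑ i, v i = 0 → z = 0) → G.IsAttainable q v z → u ≤ z) :
    ∀ᵐ t ∂volume.restrict G.period, (∀ i, v i < 0 → 0 < q i t) →
      (∀ i, 0 < ∑ j ∈ G.up i, v j → ∑ j ∈ G.up i, q j t < G.μ i) → u ≤ G.c t * ∑ i, v i := by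
  have key : ∀ n : ℕ, ∀ᵐ t ∂volume.restrict G.period,
      (∀ i, 0 ≤ q i t + 1 / ((n : ℝ) + 1) * v i ∧
        ∑ j ∈ G.up i, (q j t + 1 / ((n : ℝ) + 1) * v j) ≤ G.μ i) → u ≤ G.c t * ∑ i, v i := by
    intro n
    by_contra hs
    obtain ⟨z, hz, h1, h2, h3⟩ := hq.exists_isAttainable v u _ (by positivity) hs
    exact absurd (h z h1 h2 h3) (not_le.2 hz)
  filter_upwards [ae_all_iff.2 key, ae_all_iff.2 hq.nonneg, ae_all_iff.2 hq.capacity]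
    with t hkey h0 hcap hv hup
  have h1 : ∀ᶠ n : ℕ in Filter.atTop, ∀ i, 0 ≤ q i t + 1 / ((n : ℝ) + 1) * v i :=
    Filter.eventually_all.2 fun i => eventually_nonneg_add_mul (h0 i) (hv i)
  have h2 : ∀ᶠ n : ℕ in Filter.atTop, ∀ i,
      0 ≤ (G.μ i - ∑ j ∈ G.up i, q j t) + 1 / ((n : ℝ) + 1) * -∑ j ∈ G.up i, v j :=
    Filter.eventually_all.2 fun i => eventually_nonneg_add_mul (sub_nonneg.2 (hcap i))
      fun h => sub_pos.2 (hup i (by linarith))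
  obtain ⟨n, hn1, hn2⟩ := (h1.and h2).exists
  refine hkey n fun i => ⟨hn1 i, ?_⟩
  rw [Finset.sum_add_distrib, ← Finset.mul_sum]
  linarith [hn2 i]

lemma sum_up_single (i k : Fin N) :
    ∑ j ∈ G.up k, (Pi.single i (1 : ℝ) : Fin N → ℝ) j = if k ∈ G.down i then 1 else 0 := by
  classical
  simp [Pi.single_apply]

variable (G) in
/-- The largest gain over the schedule cost that a trip from an origin in `s` can make at time `t`,
for trip prices `r`, and zero if there is no gain. For `s = G.down i` this is the total rent of the
links that a trip from `i` uses. -/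
noncomputable def rent (r : Fin N → ℝ) (s : Finset (Fin N)) (t : ℝ) : ℝ :=
  ((s.sup fun j => (r j - G.c t).toNNReal : NNReal) : ℝ)

lemma rent_mono (r : Fin N → ℝ) {s s' : Finset (Fin N)} (h : s ⊆ s') (t : ℝ) :
    G.rent r s t ≤ G.rent r s' t :=
  NNReal.coe_le_coe.2 (Finset.sup_mono h)

lemma le_rent (r : Fin N → ℝ) {s : Finset (Fin N)} {j : Fin N} (h : j ∈ s)
    (t : ℝ) : r j - G.c t ≤ G.rent r s t :=
  (Real.le_coe_toNNReal _).trans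
    (NNReal.coe_le_coe.2 (Finset.le_sup (f := fun j => (r j - G.c t).toNNReal) h))

lemma integrable_rent (r : Fin N → ℝ) (s : Finset (Fin N)) :
    IntegrableOn (G.rent r s) G.period := by
  have hm : AEMeasurable (G.rent r s) (volume.restrict G.period) := by
    have : AEMeasurable (fun t => s.sup fun j => (r j - G.c t).toNNReal)
        (volume.restrict G.period) := by
      classical
      induction s using Finset.induction_on with
      | empty => simp
      | insert j s _ ih =>
        simp_rw [Finset.sup_insert]
        exact (G.c_measurable.const_sub (r j)).real_toNNReal.sup ih
    exact this.coe_nnreal_real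
  refine Integrable.of_bound hm.aestronglyMeasurable (∑ j, |r j|) ?_
  filter_upwards [ae_mem_period] with t ht
  rw [rent, Real.norm_of_nonneg (NNReal.coe_nonneg _)]
  have hB : 0 ≤ ∑ j, |r j| := Finset.sum_nonneg fun j _ => abs_nonneg _
  rw [← NNReal.coe_mk _ hB, NNReal.coe_le_coe]
  refine Finset.sup_le fun j _ => ?_
  rw [Real.toNNReal_le_iff_le_coe, NNReal.coe_mk]
  have h1 : |r j| ≤ ∑ j, |r j| :=
    Finset.single_le_sum (f := fun j => |r j|) (fun j _ => abs_nonneg _) (Finset.mem_univ j)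
  linarith [G.c_nonneg t ht, le_abs_self (r j)]

namespace IsScheduleOptimal

lemma price_le_of_slack (hq : G.IsScheduleOptimal q) (C : ℝ) (i : Fin N) :
    ∀ᵐ t ∂volume.restrict G.period,
      (∀ k ∈ G.down i, ∑ j ∈ G.up k, q j t < G.μ k) → G.price q C i ≤ G.c t := by
  filter_upwards [hq.1.ae_le_of_isAttainable (Pi.single i 1) (G.price q C i)
    fun z _ _ hz => hq.price_le C hz] with t ht hslack
  have := ht (fun k hk => ?_) fun k hk => ?_
  · simpa using this
  · by_cases hki : k = i
    · subst hki
      norm_num at hk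
    · simp [hki] at hk
  · rw [sum_up_single] at hk
    exact hslack k (by by_contra h; simp [h] at hk)

lemma c_le_price_of_pos (hq : G.IsScheduleOptimal q) {C : ℝ} (hC : ∀ t ∈ G.period, G.c t ≤ C)
    (i : Fin N) : ∀ᵐ t ∂volume.restrict G.period, 0 < q i t → G.c t ≤ G.price q C i := by
  filter_upwards [hq.1.ae_le_of_isAttainable (-Pi.single i 1) (-G.price q C i)
    fun z hz _ hz' => neg_le.1 (hq.le_price (hz C hC (by simp)) hz')] with t ht hpos
  have := ht (fun k hk => ?_) fun k hk => ?_
  · simpa using this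
  · by_cases hki : k = i
    · rwa [hki]
    · simp [hki] at hk
  · simp only [Pi.neg_apply, Finset.sum_neg_distrib, sum_up_single] at hk
    split_ifs at hk <;> norm_num at hk

/-- If `i` can displace flow from `j` without exceeding the capacity of a link that trips from `j`
do not use, then a trip from `i` costs at most as much as a trip from `j`. -/
lemma price_le_price_of_displace (hq : G.IsScheduleOptimal q) (C : ℝ) (i j : Fin N) :
    ∀ᵐ t ∂volume.restrict G.period, 0 < q j t →
      (∀ k ∈ G.down i, k ∉ G.down j → ∑ l ∈ G.up k, q l t < G.μ k) →
      G.price q C i ≤ G.price q C j := by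
  filter_upwards [hq.1.ae_le_of_isAttainable (Pi.single i 1 - Pi.single j 1)
    (G.price q C i - G.price q C j)
    fun z _ hz hz' => hq.price_sub_price_le C (hz (by simp)).ge hz'] with t ht hpos hslack
  have := ht (fun k hk => ?_) fun k hk => ?_
  · simpa using this
  · by_cases hkj : k = j
    · rwa [hkj]
    · have : (0 : ℝ) ≤ (Pi.single i 1 : Fin N → ℝ) k := by
        rw [Pi.single_apply]
        split_ifs <;> norm_num
      simp only [Pi.sub_apply, Pi.single_eq_of_ne hkj, sub_zero] at hk
      exact absurd hk (not_lt.2 this)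
  · simp only [Pi.sub_apply, Finset.sum_sub_distrib, sum_up_single] at hk
    by_cases h1 : k ∈ G.down i <;> by_cases h2 : k ∈ G.down j
    · simp [h1, h2] at hk
    · exact hslack k h1 h2
    · simp only [h1, h2, if_true, if_false] at hk
      norm_num at hk
    · simp [h1, h2] at hk

/-- A trip from `j` may replace a trip from an origin `i` upstream of `j`. -/
lemma price_le_price_of_pos (hq : G.IsScheduleOptimal q) (C : ℝ) {i j : Fin N}
    (hij : G.Leads i j) :
    ∀ᵐ t ∂volume.restrict G.period, 0 < q i t → G.price q C j ≤ G.price q C i := by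
  filter_upwards [hq.1.ae_le_of_isAttainable (Pi.single j 1 - Pi.single i 1)
    (G.price q C j - G.price q C i)
    fun z _ hz hz' => hq.price_sub_price_le C (hz (by simp)).ge hz'] with t ht hpos
  have := ht (fun k hk => ?_) fun k hk => ?_
  · simpa using this
  · by_cases hki : k = i
    · rwa [hki]
    · have : (0 : ℝ) ≤ (Pi.single j 1 : Fin N → ℝ) k := by
        rw [Pi.single_apply]
        split_ifs <;> norm_num
      simp only [Pi.sub_apply, Pi.single_eq_of_ne hki, sub_zero] at hk
      exact absurd hk (not_lt.2 this)
  · simp only [Pi.sub_apply, Finset.sum_sub_distrib, sum_up_single] at hk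
    by_cases h1 : k ∈ G.down j
    · have h2 : k ∈ G.down i := by
        rw [mem_down] at h1 ⊢
        exact hij.trans h1
      simp [h1, h2] at hk
    · rw [if_neg h1] at hk
      split_ifs at hk <;> norm_num at hk

/-- If trips from `i` are more expensive than trips from all origins downstream, then link `i` is
used to capacity at all times that are cheaper than the price at `i`. Otherwise link `i` is
slack at such a time; the first saturated link `j` downstream of `i` then carries flow from
`j` itself, since its capacity covers that of its upstream links, and `i` could displace this flow.
If there is no saturated link, `i` could use this time at once. -/
lemma capacity_eq_of_price_lt (hq : G.IsScheduleOptimal q) (C : ℝ) (i : Fin N)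
    (hi : ∀ j ∈ (G.down i).erase i, G.price q C j < G.price q C i) :
    ∀ᵐ t ∂volume.restrict G.period, G.c t < G.price q C i →
      ∑ j ∈ G.up i, q j t = G.μ i := by
  filter_upwards [ae_all_iff.2 fun j => hq.price_le_price_of_displace C i j,
    hq.price_le_of_slack C i, ae_all_iff.2 hq.1.capacity]
    with t hdis hslack hcap hc
  by_contra hne
  have hlt : ∑ j ∈ G.up i, q j t < G.μ i := lt_of_le_of_ne (hcap i) hne
  have walk : ∀ j, G.Leads i j → (∀ k ∈ G.down i, k ∉ G.down j → ∑ l ∈ G.up k, q l t < G.μ k) ∧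
      ∑ l ∈ G.up j, q l t < G.μ j := by
    intro j hij
    induction hij with
    | refl => exact ⟨fun k hk hk' => absurd hk hk', hlt⟩
    | @tail j j' hij hj ih =>
      have hbefore : ∀ k ∈ G.down i, k ∉ G.down j' → ∑ l ∈ G.up k, q l t < G.μ k := by
        intro k hk hk'
        by_cases hkj : k ∈ G.down j
        · rw [← down_erase_of_parent hj, Finset.mem_erase, not_and'] at hk'
          rw [not_ne_iff.1 (hk' hkj)]
          exact ih.2
        · exact ih.1 k hk hkj
      refine ⟨hbefore, lt_of_le_of_ne (hcap j') fun heq => ?_⟩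
      have hpos : 0 < q j' t := by
        have h1 := sum_up (G := G) j' fun l => q l t
        have h2 : ∑ c with G.parent c = some j', ∑ l ∈ G.up c, q l t <
            ∑ c with G.parent c = some j', G.μ c :=
          Finset.sum_lt_sum (fun c _ => hcap c) ⟨j, by simpa using hj, ih.2⟩
        have h3 := G.capacity_le j'
        linarith
      have hij' : G.Leads i j' := hij.tail hj
      refine absurd (hdis j' hpos hbefore) (not_le.2 (hi j' ?_))
      rw [Finset.mem_erase, mem_down]
      refine ⟨?_, hij'⟩
      rintro rfl
      exact not_leads_of_parent hj hij
  exact absurd (hslack fun k hk => (walk k (by simpa using hk)).2) (not_le.2 hc)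

/-- The prices of the trips and the differences of the rents are multipliers for a flow with minimal
schedule cost. -/
theorem exists_optimalityConditions (hq : G.IsScheduleOptimal q)
    (hdem : ∀ i, ∫ t in G.period, q i t = G.Q i) :
    ∃ (ρ : Fin N → ℝ) (p : Fin N → ℝ → ℝ), G.OptimalityConditions q ρ p := by
  obtain ⟨C, hC⟩ := G.exists_c_le
  set r := G.price q C with hr
  have hsum : ∀ i t, ∑ j ∈ G.down i,
      (G.rent r (G.down j) t - G.rent r ((G.down j).erase j) t + G.d j) =
      G.rent r (G.down i) t + ∑ j ∈ G.down i, G.d j := by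
    intro i t
    rw [Finset.sum_add_distrib, sum_down_telescope (fun s => G.rent r s t)]
    simp [rent]
  have hmem : ∀ i, i ∈ G.down i := fun i => by simpa using G.leads_refl i
  refine ⟨fun i => r i + ∑ j ∈ G.down i, G.d j,
    fun i t => G.rent r (G.down i) t - G.rent r ((G.down i).erase i) t,
    fun i => (integrable_rent r _).sub (integrable_rent r _),
    fun i t _ => sub_nonneg.2 (rent_mono r (Finset.erase_subset _ _) t), hdem, fun i => ?_,
    fun i => ae_of_all _ fun t _ => ?_, fun i => ?_, fun i => ?_⟩
  · have hle : ∀ᵐ t ∂volume.restrict G.period, ∀ j ∈ G.down i, 0 < q i t → r j ≤ r i := by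
      simp only [mem_down]
      rw [ae_all_iff]
      intro j
      by_cases hij : G.Leads i j
      · filter_upwards [hq.price_le_price_of_pos C hij] with t ht _ using ht
      · exact ae_of_all _ fun t h => absurd h hij
    filter_upwards [hle, hq.c_le_price_of_pos hC i] with t hle hc hpos
    rw [hsum]
    have h1 : G.rent r (G.down i) t = r i - G.c t := by
      refine le_antisymm ?_ (le_rent r (hmem i) t)
      rw [← NNReal.coe_mk _ (sub_nonneg.2 (hc hpos)), rent, NNReal.coe_le_coe]
      refine Finset.sup_le fun j hj => ?_
      rw [Real.toNNReal_le_iff_le_coe, NNReal.coe_mk]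
      linarith [hle j hj hpos]
    rw [h1]
    ring
  · rw [hsum]
    linarith [le_rent (G := G) r (hmem i) t]
  · by_cases hi : ∀ j ∈ (G.down i).erase i, r j < r i
    · filter_upwards [hq.capacity_eq_of_price_lt C i hi] with t ht hp
      refine ht ?_
      by_contra hc
      -- the term of `i` vanishes, and dropping it does not change the rent
      have h1 : (r i - G.c t).toNNReal = 0 := Real.toNNReal_of_nonpos (by linarith)
      have h2 : G.rent r (G.down i) t = G.rent r ((G.down i).erase i) t := by
        rw [rent, ← Finset.insert_erase (hmem i), Finset.sup_insert, h1]
        simp [rent]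
      linarith
    · refine ae_of_all _ fun t hp => ?_
      push Not at hi
      obtain ⟨j, hj, hij⟩ := hi
      have h2 : G.rent r (G.down i) t = G.rent r ((G.down i).erase i) t := by
        refine le_antisymm ?_ (rent_mono r (Finset.erase_subset _ _) t)
        rw [rent, rent, NNReal.coe_le_coe]
        conv_lhs => rw [← Finset.insert_erase (hmem i), Finset.sup_insert]
        refine sup_le ((Real.toNNReal_le_toNNReal (by linarith)).trans
          (Finset.le_sup (f := fun j => (r j - G.c t).toNNReal) hj)) le_rfl
      linarith
  · filter_upwards [hq.1.capacity i] with t ht _ using ht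

end IsScheduleOptimal
end TreeNetwork

/-! ### Time change by absolutely continuous functions -/

section TimeChange

variable {a b : ℝ} {σ : ℝ → ℝ}

lemma AbsolutelyContinuousOnInterval.strictMonoOn_of_deriv_pos (hab : a ≤ b)
    (hσ : AbsolutelyContinuousOnInterval σ a b)
    (hpos : ∀ᵐ t ∂volume.restrict (Icc a b), 0 < deriv σ t) : StrictMonoOn σ (Icc a b) := by
  intro s hs t ht hst
  have hsub : Icc s t ⊆ Icc a b := Icc_subset_Icc hs.1 ht.2
  have hst' : AbsolutelyContinuousOnInterval σ s t :=
    hσ.mono (by rw [uIcc_of_le hst.le, uIcc_of_le hab]; exact hsub)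
  have hpos' : ∀ᵐ x ∂volume.restrict (Ioc s t), 0 < deriv σ x :=
    ae_restrict_of_ae_restrict_of_subset (Ioc_subset_Icc_self.trans hsub) hpos
  have hint := hst'.intervalIntegrable_deriv
  rw [← sub_pos, ← hst'.integral_deriv_eq_sub, intervalIntegral.integral_of_le hst.le,
    integral_pos_iff_support_of_nonneg_ae (hpos'.mono fun _ h => h.le) hint.1]
  have hsupp : (volume.restrict (Ioc s t)) (Function.support (deriv σ))ᶜ = 0 := by
    refine measure_mono_null (fun x hx => ?_) hpos'
    simp only [mem_compl_iff, Function.mem_support, not_not] at hx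
    simp [hx]
  rw [measure_congr (ae_eq_univ.2 hsupp)]
  simpa using hst

/-- Change of variables for a strictly increasing absolutely continuous function. -/
lemma AbsolutelyContinuousOnInterval.map_withDensity_deriv (hab : a ≤ b)
    (hσ : AbsolutelyContinuousOnInterval σ a b)
    (hpos : ∀ᵐ t ∂volume.restrict (Icc a b), 0 < deriv σ t) :
    ((volume.restrict (Icc a b)).withDensity fun t => ENNReal.ofReal (deriv σ t)).map σ =
      volume.restrict (Icc (σ a) (σ b)) := by
  have hmono := hσ.strictMonoOn_of_deriv_pos hab hpos
  have hcont : ContinuousOn σ (Icc a b) := by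
    have := hσ.continuousOn
    rwa [uIcc_of_le hab] at this
  have hσm : AEMeasurable σ (volume.restrict (Icc a b)) := hcont.aemeasurable measurableSet_Icc
  have hint : IntegrableOn (deriv σ) (Icc a b) := by
    rw [integrableOn_Icc_iff_integrableOn_Ioc]
    exact hσ.intervalIntegrable_deriv.1
  have : IsFiniteMeasure ((volume.restrict (Icc a b)).withDensity
      fun t => ENNReal.ofReal (deriv σ t)) := isFiniteMeasure_withDensity_ofReal hint.2
  refine Measure.ext_of_Iic _ _ fun x => ?_
  rw [Measure.map_apply_of_aemeasurable (hσm.mono_ac (withDensity_absolutelyContinuous _ _))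
    measurableSet_Iic, withDensity_apply', Measure.restrict_apply measurableSet_Iic]
  have ha : a ∈ Icc a b := left_mem_Icc.2 hab
  have hb : b ∈ Icc a b := right_mem_Icc.2 hab
  rw [Measure.restrict_restrict₀' measurableSet_Icc.nullMeasurableSet]
  rcases lt_or_ge x (σ a) with hx | hx
  · have h1 : σ ⁻¹' Iic x ∩ Icc a b = ∅ := by
      ext t
      simp only [mem_inter_iff, mem_preimage, mem_Iic, mem_empty_iff_false, iff_false, not_and']
      exact fun ht => not_le.2 (hx.trans_le (hmono.monotoneOn ha ht ht.1))
    have h2 : Iic x ∩ Icc (σ a) (σ b) = ∅ := by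
      ext t
      simp only [mem_inter_iff, mem_Iic, mem_empty_iff_false, iff_false, not_and']
      exact fun ht => not_le.2 (hx.trans_le ht.1)
    rw [h1, h2]
    simp
  · obtain ⟨t, ht, hσt⟩ : min x (σ b) ∈ σ '' Icc a b :=
      intermediate_value_Icc hab hcont ⟨le_min hx (hmono.monotoneOn ha hb hab), min_le_right _ _⟩
    have h1 : σ ⁻¹' Iic x ∩ Icc a b = Icc a t := by
      ext s
      simp only [mem_inter_iff, mem_preimage, mem_Iic]
      constructor
      · rintro ⟨hs, hs'⟩
        refine ⟨hs'.1, (hmono.le_iff_le hs' ht).1 ?_⟩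
        rw [hσt]
        exact le_min hs (hmono.monotoneOn hs' hb hs'.2)
      · intro hs
        have hs' : s ∈ Icc a b := ⟨hs.1, hs.2.trans ht.2⟩
        refine ⟨((hmono.monotoneOn hs' ht hs.2).trans hσt.le).trans (min_le_left _ _), hs'⟩
    have h2 : Iic x ∩ Icc (σ a) (σ b) = Icc (σ a) (σ t) := by
      ext s
      simp only [mem_inter_iff, mem_Iic, mem_Icc, hσt, le_min_iff]
      tauto
    have hsub : Icc a t ⊆ Icc a b := Icc_subset_Icc_right ht.2
    rw [h1, h2, Real.volume_Icc, ← ofReal_integral_eq_lintegral_ofReal (hint.mono_set hsub)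
      ((ae_restrict_of_ae_restrict_of_subset hsub hpos).mono fun _ h => h.le),
      integral_Icc_eq_integral_Ioc, ← intervalIntegral.integral_of_le ht.1,
      (hσ.mono (by rw [uIcc_of_le ht.1, uIcc_of_le hab]; exact hsub)).integral_deriv_eq_sub]

end TimeChange

/-! ### Outflows of the bottlenecks -/

namespace TreeNetwork

variable {N : ℕ} {G : TreeNetwork N} {q w : Fin N → ℝ → ℝ}

variable (G) in
/-- The bottleneck departure time at link `i`, up to the free-flow travel times, of the trips that
arrive at the destination at time `t`. -/
noncomputable def departure (w : Fin N → ℝ → ℝ) (i : Fin N) (t : ℝ) : ℝ :=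
  t - ∑ j ∈ (G.down i).erase i, w j t

lemma departure_of_root {i : Fin N} (h : G.parent i = none) : G.departure w i = id := by
  ext t
  simp [departure, down_erase_of_root h]

lemma departure_of_parent {i c : Fin N} (h : G.parent c = some i) (t : ℝ) :
    G.departure w c t = G.departure w i t - w i t := by
  have hi : i ∈ G.down i := by simpa using G.leads_refl i
  rw [departure, departure, down_erase_of_parent h, ← Finset.add_sum_erase _ _ hi]
  ring

lemma absolutelyContinuousOnInterval_sum {ι : Type*} (s : Finset ι) {f : ι → ℝ → ℝ} {a b : ℝ}
    (hf : ∀ i ∈ s, AbsolutelyContinuousOnInterval (f i) a b) :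
    AbsolutelyContinuousOnInterval (fun t => ∑ i ∈ s, f i t) a b := by
  classical
  induction s using Finset.induction_on with
  | empty =>
    simpa using (LipschitzWith.const (0 : ℝ)).lipschitzOnWith.absolutelyContinuousOnInterval
      (a := a) (b := b)
  | insert i s hi ih =>
    simp_rw [Finset.sum_insert hi]
    exact (hf i (Finset.mem_insert_self i s)).fun_add
      (ih fun j hj => hf j (Finset.mem_insert_of_mem hj))

namespace IsFeasible

lemma absolutelyContinuous_departure (h : G.IsFeasible q w) (i : Fin N) :
    AbsolutelyContinuousOnInterval (G.departure w i) G.a G.b := by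
  have h1 : AbsolutelyContinuousOnInterval (fun t : ℝ => t) G.a G.b :=
    (LipschitzWith.id.lipschitzOnWith).absolutelyContinuousOnInterval
  exact h1.fun_sub (absolutelyContinuousOnInterval_sum _ fun j _ => h.w_absCont j)

lemma deriv_departure (h : G.IsFeasible q w) (i : Fin N) : ∀ᵐ t ∂volume.restrict G.period,
    deriv (G.departure w i) t = G.sigmaDot w i t := by
  have hd : ∀ᵐ t ∂volume.restrict G.period, ∀ j, DifferentiableAt ℝ (w j) t := by
    rw [ae_all_iff]
    intro j
    rw [ae_restrict_iff' measurableSet_period, period, ← uIcc_of_le G.a_lt_b.le]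
    exact (h.w_absCont j).ae_differentiableAt
  filter_upwards [hd] with t ht
  have h1 : HasDerivAt (G.departure w i) (1 - ∑ j ∈ (G.down i).erase i, deriv (w j) t) t :=
    (hasDerivAt_id t).sub (HasDerivAt.fun_sum fun j _ => (ht j).hasDerivAt)
  exact h1.deriv

lemma sigmaDot_pos (h : G.IsFeasible q w) (i : Fin N) :
    ∀ᵐ t ∂volume.restrict G.period, 0 < G.sigmaDot w i t := by
  unfold sigmaDot
  cases hi : G.parent i with
  | none => simp [down_erase_of_root hi]
  | some j =>
    rw [down_erase_of_parent hi]
    filter_upwards [h.w_deriv j] with t ht using sub_pos.2 ht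

lemma deriv_departure_pos (h : G.IsFeasible q w) (i : Fin N) : ∀ᵐ t ∂volume.restrict G.period,
    0 < deriv (G.departure w i) t := by
  filter_upwards [h.deriv_departure i, h.sigmaDot_pos i] with t h1 h2
  rwa [h1]

lemma strictMonoOn_departure (h : G.IsFeasible q w) (i : Fin N) :
    StrictMonoOn (G.departure w i) G.period :=
  (h.absolutelyContinuous_departure i).strictMonoOn_of_deriv_pos G.a_lt_b.le
    (h.deriv_departure_pos i)

lemma continuousOn_departure (h : G.IsFeasible q w) (i : Fin N) :
    ContinuousOn (G.departure w i) G.period := by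
  have := (h.absolutelyContinuous_departure i).continuousOn
  rwa [uIcc_of_le G.a_lt_b.le] at this

lemma continuousOn_w (h : G.IsFeasible q w) (i : Fin N) : ContinuousOn (w i) G.period := by
  have := (h.w_absCont i).continuousOn
  rwa [uIcc_of_le G.a_lt_b.le] at this

lemma aemeasurable_departure (h : G.IsFeasible q w) (i : Fin N) :
    AEMeasurable (G.departure w i) (volume.restrict G.period) :=
  (h.continuousOn_departure i).aemeasurable measurableSet_period

lemma map_departure (h : G.IsFeasible q w) (i : Fin N) :
    ((volume.restrict G.period).withDensity
      fun t => ENNReal.ofReal (G.sigmaDot w i t)).map (G.departure w i) =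
      volume.restrict (Icc G.a (G.departure w i G.b)) := by
  have h1 := (h.absolutelyContinuous_departure i).map_withDensity_deriv G.a_lt_b.le
    (h.deriv_departure_pos i)
  have h2 : G.departure w i G.a = G.a := by simp [departure, h.w_start]
  rw [h2] at h1
  rw [← h1]
  congr 1
  refine withDensity_congr_ae ?_
  filter_upwards [h.deriv_departure i] with t ht
  rw [ht]

lemma flow_nonneg (h : G.IsFeasible q w) (i : Fin N) :
    ∀ᵐ t ∂volume.restrict G.period, 0 ≤ ∑ j ∈ G.up i, q j t := by
  filter_upwards [ae_all_iff.2 h.q_nonneg] with t ht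
  exact Finset.sum_nonneg fun j _ => ht j

lemma integrable_flow (h : G.IsFeasible q w) (i : Fin N) :
    IntegrableOn (fun t => ∑ j ∈ G.up i, q j t) G.period :=
  integrable_finsetSum _ fun j _ => h.q_integrable j

lemma flow_le (h : G.IsFeasible q w) (i : Fin N) : ∀ᵐ t ∂volume.restrict G.period,
    ∑ j ∈ G.up i, q j t ≤ G.μ i * G.sigmaDot w i t := by
  filter_upwards [h.queue_pos i, h.queue_zero i, ae_mem_period] with t h1 h2 ht
  rcases (h.w_nonneg i t ht).eq_or_lt with h0 | h0
  · exact h2 h0.symm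
  · exact (h1 h0).le

end IsFeasible

variable (G q w) in
/-- The flow through link `i` as a measure on the bottleneck departure times: the number of trips
that leave the bottleneck `i` during a set of times. -/
noncomputable def outflow (i : Fin N) : Measure ℝ :=
  ((volume.restrict G.period).withDensity
    fun t => ENNReal.ofReal (∑ j ∈ G.up i, q j t)).map (G.departure w i)

namespace IsFeasible

lemma outflow_apply (h : G.IsFeasible q w) (i : Fin N) {B : Set ℝ} (hB : MeasurableSet B) :
    G.outflow q w i B = ∫⁻ t in G.departure w i ⁻¹' B,
      ENNReal.ofReal (∑ j ∈ G.up i, q j t) ∂volume.restrict G.period := by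
  rw [outflow, Measure.map_apply_of_aemeasurable
    ((h.aemeasurable_departure i).mono_ac (withDensity_absolutelyContinuous _ _)) hB,
    withDensity_apply']

lemma lintegral_sigmaDot (h : G.IsFeasible q w) (i : Fin N) {B : Set ℝ} (hB : MeasurableSet B) :
    ∫⁻ t in G.departure w i ⁻¹' B, ENNReal.ofReal (G.μ i * G.sigmaDot w i t)
      ∂volume.restrict G.period =
      ENNReal.ofReal (G.μ i) * volume (B ∩ Icc G.a (G.departure w i G.b)) := by
  rw [← Measure.restrict_apply hB, ← h.map_departure i, Measure.map_apply_of_aemeasurable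
    ((h.aemeasurable_departure i).mono_ac (withDensity_absolutelyContinuous _ _)) hB,
    withDensity_apply', ← lintegral_const_mul' _ _ ENNReal.ofReal_ne_top]
  simp_rw [ENNReal.ofReal_mul (G.μ_nonneg i)]

/-- The bottleneck discharges at most at the rate `μ i`. -/
lemma outflow_le (h : G.IsFeasible q w) (i : Fin N) {B : Set ℝ} (hB : MeasurableSet B) :
    G.outflow q w i B ≤
      ENNReal.ofReal (G.μ i) * volume (B ∩ Icc G.a (G.departure w i G.b)) := by
  rw [h.outflow_apply i hB, ← h.lintegral_sigmaDot i hB]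
  refine lintegral_mono_ae (ae_restrict_of_ae ?_)
  filter_upwards [h.flow_le i] with t ht
  exact ENNReal.ofReal_le_ofReal ht

lemma departure_le (h : G.IsFeasible q w) (i : Fin N) {t : ℝ} (ht : t ∈ G.period) :
    G.departure w i t ≤ t :=
  sub_le_self _ (Finset.sum_nonneg fun j _ => h.w_nonneg j t ht)

/-- At every time, the bottlenecks that enter node `i` discharge at most as much as
bottleneck `i`: if there is a queue at `i`, it discharges at its full capacity, which covers the
capacities of the entering links. Otherwise the trips leave the bottleneck `i` at the time at
which they arrive there. -/
lemma sum_outflow_le (h : G.IsFeasible q w) (i : Fin N) {B : Set ℝ} (hB : MeasurableSet B) :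
    ∑ c with G.parent c = some i, G.outflow q w c B ≤ G.outflow q w i B := by
  have hb : G.b ∈ G.period := right_mem_Icc.2 G.a_lt_b.le
  -- departure times without a queue at `i`
  set Z : Set ℝ := G.period ∩ w i ⁻¹' {0} with hZ
  set S : Set ℝ := G.departure w i '' Z with hS
  have hZc : IsCompact Z :=
    isCompact_Icc.of_isClosed_subset
      ((h.continuousOn_w i).preimage_isClosed_of_isClosed isClosed_Icc isClosed_singleton)
      inter_subset_left
  have hSm : MeasurableSet S :=
    (hZc.image_of_continuousOn ((h.continuousOn_departure i).mono inter_subset_left)).measurableSet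
  have hZS : ∀ t ∈ G.period, (G.departure w i t ∈ S ↔ w i t = 0) := by
    intro t ht
    constructor
    · rintro ⟨s, hs, hst⟩
      rw [← (h.strictMonoOn_departure i).injOn hs.1 ht hst]
      exact hs.2
    · exact fun h0 => ⟨t, ⟨ht, h0⟩, rfl⟩
  have hZc : ∀ c, G.parent c = some i → ∀ t ∈ G.period,
      G.departure w c t ∈ S → w i t = 0 := by
    rintro c hc t ht ⟨s, hs, hst⟩
    have hs0 : w i s = 0 := hs.2
    have : G.departure w c s = G.departure w i s := by
      rw [departure_of_parent hc, hs0, sub_zero]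
    rw [← (h.strictMonoOn_departure c).injOn hs.1 ht (this.trans hst)]
    exact hs0
  have hsplit : ∀ k, G.outflow q w k B = G.outflow q w k (B ∩ S) + G.outflow q w k (B \ S) :=
    fun k => (measure_inter_add_sdiff B hSm).symm
  simp_rw [hsplit]
  rw [Finset.sum_add_distrib]
  refine add_le_add ?_ ?_
  · have hBS := hB.inter hSm
    have hpre : ∀ c ∈ ({c | G.parent c = some i} : Finset (Fin N)),
        G.outflow q w c (B ∩ S) = ∫⁻ t in G.departure w i ⁻¹' (B ∩ S),
          ENNReal.ofReal (∑ j ∈ G.up c, q j t) ∂volume.restrict G.period := by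
      intro c hc
      replace hc : G.parent c = some i := by simpa using hc
      rw [h.outflow_apply c hBS]
      refine setLIntegral_congr ?_
      filter_upwards [ae_mem_period] with t ht
      refine propext ⟨fun hm => ?_, fun hm => ?_⟩
      · have h0 := hZc c hc t ht hm.2
        have heq := departure_of_parent (w := w) hc t
        rw [h0, sub_zero] at heq
        change G.departure w i t ∈ B ∩ S
        rw [← heq]
        exact hm
      · have h0 := (hZS t ht).1 hm.2
        have heq := departure_of_parent (w := w) hc t
        rw [h0, sub_zero] at heq
        change G.departure w c t ∈ B ∩ S
        rw [heq]
        exact hm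
    rw [Finset.sum_congr rfl hpre, h.outflow_apply i hBS, ← lintegral_finsetSum']
    · refine lintegral_mono_ae (ae_restrict_of_ae ?_)
      filter_upwards [ae_all_iff.2 h.flow_nonneg, h.q_nonneg i] with t ht hqi
      rw [← ENNReal.ofReal_sum_of_nonneg fun c _ => ht c]
      refine ENNReal.ofReal_le_ofReal ?_
      rw [sum_up (G := G) i]
      linarith
    · intro c _
      exact (h.integrable_flow c).aemeasurable.ennreal_ofReal.restrict
  · have hBS := hB.diff hSm
    have hi : G.outflow q w i (B \ S) =
        ENNReal.ofReal (G.μ i) * volume ((B \ S) ∩ Icc G.a (G.departure w i G.b)) := by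
      rw [h.outflow_apply i hBS, ← h.lintegral_sigmaDot i hBS]
      refine lintegral_congr_ae ((ae_restrict_iff'₀
        ((h.aemeasurable_departure i).nullMeasurable hBS)).2 ?_)
      filter_upwards [h.queue_pos i, ae_mem_period] with t ht hmem hm
      rw [ht ((h.w_nonneg i t hmem).lt_of_ne fun h0 => hm.2 ((hZS t hmem).2 h0.symm))]
    rw [hi]
    calc ∑ c with G.parent c = some i, G.outflow q w c (B \ S)
        ≤ ∑ c with G.parent c = some i, ENNReal.ofReal (G.μ c) *
            volume ((B \ S) ∩ Icc G.a (G.departure w i G.b)) := by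
          refine Finset.sum_le_sum fun c hc => (h.outflow_le c hBS).trans ?_
          have hle : G.departure w c G.b ≤ G.departure w i G.b := by
            rw [departure_of_parent (by simpa using hc)]
            exact sub_le_self _ (h.w_nonneg i _ hb)
          gcongr
      _ = ENNReal.ofReal (∑ c with G.parent c = some i, G.μ c) *
            volume ((B \ S) ∩ Icc G.a (G.departure w i G.b)) := by
          rw [← Finset.sum_mul, ENNReal.ofReal_sum_of_nonneg fun c _ => G.μ_nonneg c]
      _ ≤ _ := by
          gcongr
          exact G.capacity_le i

end IsFeasible
end TreeNetwork

/-! ### Removing the queues -/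

namespace TreeNetwork

variable {N : ℕ} {G : TreeNetwork N} {q w : Fin N → ℝ → ℝ}

namespace IsFeasible

lemma outflow_apply_le (h : G.IsFeasible q w) (i : Fin N) {B : Set ℝ} (hB : MeasurableSet B) :
    G.outflow q w i B ≤ ∫⁻ _ in B, ENNReal.ofReal (G.μ i) ∂volume.restrict G.period := by
  refine (h.outflow_le i hB).trans ?_
  rw [setLIntegral_const, Measure.restrict_apply hB]
  gcongr
  exact Icc_subset_Icc_right (h.departure_le i (right_mem_Icc.2 G.a_lt_b.le))

/-- The outflow rates of the bottlenecks respect the capacities, and the rate at a link covers the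
rates at the links that enter its origin. At the links that end in the destination they are the
original link flows. -/
lemma exists_outflow_density (h : G.IsFeasible q w) : ∃ f : Fin N → ℝ → ℝ,
    (∀ i, IntegrableOn (f i) G.period) ∧
    (∀ i, ∀ᵐ t ∂volume.restrict G.period, f i t ≤ G.μ i) ∧
    (∀ i, ∀ᵐ t ∂volume.restrict G.period, ∑ c with G.parent c = some i, f c t ≤ f i t) ∧
    (∀ i, ∫ t in G.period, f i t = ∫ t in G.period, ∑ j ∈ G.up i, q j t) ∧
    (∀ i, G.parent i = none →
      ∀ᵐ t ∂volume.restrict G.period, f i t = ∑ j ∈ G.up i, q j t) := by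
  set ν := volume.restrict G.period with hν
  have hfin : ∀ i, IsFiniteMeasure (G.outflow q w i) := by
    intro i
    have := isFiniteMeasure_withDensity_ofReal (h.integrable_flow i).2
    unfold outflow
    infer_instance
  have hac : ∀ i, G.outflow q w i ≪ ν := fun i =>
    Measure.AbsolutelyContinuous.mk fun B hB h0 => by
      refine le_antisymm ((h.outflow_apply_le i hB).trans ?_) zero_le
      rw [setLIntegral_const, h0, mul_zero]
  set D : Fin N → ℝ → ENNReal := fun i => (G.outflow q w i).rnDeriv ν with hD
  have hDm : ∀ i, Measurable (D i) := fun i => Measure.measurable_rnDeriv _ _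
  have hDB : ∀ i (B : Set ℝ), ∫⁻ t in B, D i t ∂ν = G.outflow q w i B :=
    fun i B => Measure.setLIntegral_rnDeriv (hac i) B
  have hDtop : ∀ i, ∀ᵐ t ∂ν, D i t < ⊤ := fun i => Measure.rnDeriv_lt_top _ _
  have hDμ : ∀ i, ∀ᵐ t ∂ν, D i t ≤ ENNReal.ofReal (G.μ i) := fun i =>
    ae_le_of_forall_setLIntegral_le_of_sigmaFinite (hDm i) fun B hB _ => by
      rw [hDB i B]
      exact h.outflow_apply_le i hB
  have hDsum : ∀ i, ∀ᵐ t ∂ν, ∑ c with G.parent c = some i, D c t ≤ D i t := fun i =>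
    ae_le_of_forall_setLIntegral_le_of_sigmaFinite
      (Finset.measurable_fun_sum _ fun c _ => hDm c) fun B hB _ => by
      rw [lintegral_finsetSum _ fun c _ => hDm c, hDB i B,
        Finset.sum_congr rfl fun c _ => hDB c B]
      exact h.sum_outflow_le i hB
  refine ⟨fun i t => (D i t).toReal, fun i => Measure.integrable_toReal_rnDeriv,
    fun i => ?_, fun i => ?_, fun i => ?_, fun i hi => ?_⟩
  · filter_upwards [hDμ i] with t ht
    exact ENNReal.toReal_le_of_le_ofReal (G.μ_nonneg i) ht
  · filter_upwards [hDsum i, ae_all_iff.2 hDtop] with t ht htop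
    rw [← ENNReal.toReal_sum fun c _ => (htop c).ne]
    exact ENNReal.toReal_mono (htop i).ne ht
  · rw [integral_toReal (hDm i).aemeasurable (hDtop i), ← setLIntegral_univ,
      hDB i _, h.outflow_apply i MeasurableSet.univ, preimage_univ,
      setLIntegral_univ, integral_eq_lintegral_of_nonneg_ae (h.flow_nonneg i)
        (h.integrable_flow i).aestronglyMeasurable]
  · have h1 : G.outflow q w i =
        ν.withDensity fun t => ENNReal.ofReal (∑ j ∈ G.up i, q j t) := by
      rw [outflow, departure_of_root hi, Measure.map_id]
    have h2 : D i =ᵐ[ν] fun t => ENNReal.ofReal (∑ j ∈ G.up i, q j t) := by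
      simp only [hD, h1]
      exact Measure.rnDeriv_withDensity₀ ν (h.integrable_flow i).aemeasurable.ennreal_ofReal
    filter_upwards [h2, h.flow_nonneg i] with t ht h0
    rw [ht, ENNReal.toReal_ofReal h0]

/-- The queues can be avoided without a change of the total flow rate at the destination: choose
the inflow rates whose link flows are the outflow rates of the bottlenecks in the presence of
the queues. -/
lemma exists_isAdmissible (h : G.IsFeasible q w) : ∃ q', G.IsAdmissible q' ∧
    (∀ i, ∫ t in G.period, q' i t = ∫ t in G.period, q i t) ∧
    G.scheduleCost q' = G.scheduleCost q := by
  obtain ⟨f, hint, hμ, hsum, hflow, hroot⟩ := h.exists_outflow_density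
  have hint' : ∀ i, IntegrableOn (fun t => f i t - ∑ c with G.parent c = some i, f c t) G.period :=
    fun i => (hint i).sub (integrable_finsetSum _ fun c _ => hint c)
  have hcost : ∀ r : Fin N → ℝ → ℝ, (∀ i, IntegrableOn (r i) G.period) →
      G.scheduleCost r = ∫ t in G.period, G.c t * ∑ i, r i t := by
    intro r hr
    unfold scheduleCost
    rw [← integral_finsetSum _ fun i _ => integrable_c_mul (hr i)]
    simp_rw [Finset.mul_sum]
  refine ⟨fun i t => f i t - ∑ c with G.parent c = some i, f c t, ⟨hint', fun i => ?_, fun i => ?_⟩,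
    fun i => ?_, ?_⟩
  · filter_upwards [hsum i] with t ht using sub_nonneg.2 ht
  · filter_upwards [hμ i] with t ht
    rwa [sum_up_net (G := G) (fun i => f i t) i]
  · rw [integral_sub (hint i) (integrable_finsetSum _ fun c _ => hint c),
      integral_finsetSum _ fun c _ => hint c, hflow, Finset.sum_congr rfl fun c _ => hflow c]
    rw [← integral_finsetSum _ fun c _ => h.integrable_flow c,
      ← integral_sub (h.integrable_flow i) (integrable_finsetSum _ fun c _ => h.integrable_flow c)]
    refine integral_congr_ae (ae_of_all _ fun t => ?_)
    beta_reduce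
    rw [sum_up (G := G) i]
    ring
  · rw [hcost _ hint', hcost _ h.q_integrable]
    have hroot' : ∀ᵐ t ∂volume.restrict G.period, ∀ i, G.parent i = none →
        f i t = ∑ j ∈ G.up i, q j t := by
      rw [ae_all_iff]
      intro i
      by_cases hi : G.parent i = none
      · filter_upwards [hroot i hi] with t ht _ using ht
      · exact ae_of_all _ fun t h0 => absurd h0 hi
    refine integral_congr_ae ?_
    filter_upwards [hroot'] with t ht
    rw [sum_net (G := G) fun i => f i t, sum_eq_sum_root (G := G) fun i => q i t]
    congr 1
    exact Finset.sum_congr rfl fun i hi => ht i (by simpa using hi)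

lemma integrable_w_mul (h : G.IsFeasible q w) (i j : Fin N) :
    IntegrableOn (fun t => w j t * q i t) G.period :=
  (h.q_integrable i).continuousOn_mul (h.continuousOn_w j) isCompact_Icc

lemma cost_eq (h : G.IsFeasible q w) :
    G.cost q w = G.scheduleCost q + ∑ i, (∑ j ∈ G.down i, G.d j) * G.Q i +
    ∑ i, ∑ j ∈ G.down i, ∫ t in G.period, w j t * q i t := by
  unfold cost scheduleCost
  rw [← Finset.sum_add_distrib, ← Finset.sum_add_distrib]
  refine Finset.sum_congr rfl fun i _ => ?_
  have h1 : IntegrableOn (fun t => G.c t * q i t + (∑ j ∈ G.down i, G.d j) * q i t) G.period :=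
    (integrable_c_mul (h.q_integrable i)).add ((h.q_integrable i).const_mul _)
  rw [← h.demand i, ← integral_finsetSum _ fun j _ => h.integrable_w_mul i j,
    ← integral_const_mul, ← integral_add (integrable_c_mul (h.q_integrable i))
      ((h.q_integrable i).const_mul _),
    ← integral_add h1 (integrable_finsetSum _ fun j _ => h.integrable_w_mul i j)]
  refine integral_congr_ae (ae_of_all _ fun t => ?_)
  beta_reduce
  rw [← Finset.sum_mul, Finset.sum_add_distrib]
  ring

end IsFeasible

lemma IsAdmissible.isFeasible (hq : G.IsAdmissible q)
    (hdem : ∀ i, ∫ t in G.period, q i t = G.Q i) : G.IsFeasible q fun _ _ => 0 where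
  q_integrable := hq.integrable
  w_absCont _ := (LipschitzWith.const (0 : ℝ)).lipschitzOnWith.absolutelyContinuousOnInterval
  w_nonneg _ _ _ := le_rfl
  w_start _ := rfl
  queue_pos _ := ae_of_all _ fun _ ht => absurd ht (lt_irrefl _)
  queue_zero i := by
    filter_upwards [hq.capacity i] with t ht _
    simpa [sigmaDot] using ht
  demand := hdem
  q_nonneg := hq.nonneg
  w_deriv i := ae_of_all _ fun t => by simp

namespace IsOptimal

lemma queueCost_nonpos (h : G.IsOptimal q w) :
    ∑ i, ∑ j ∈ G.down i, ∫ t in G.period, w j t * q i t ≤ 0 := by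
  obtain ⟨q', hq', hdem, hcost⟩ := h.1.exists_isAdmissible
  have hf := hq'.isFeasible fun i => (hdem i).trans (h.1.demand i)
  have := h.2 _ _ hf
  rw [h.1.cost_eq, hf.cost_eq, hcost] at this
  simpa using this

/-- In an optimal solution there is no queue at a link with positive capacity. -/
lemma w_eq_zero (h : G.IsOptimal q w) {j : Fin N} (hj : 0 < G.μ j) :
    ∀ t ∈ G.period, w j t = 0 := by
  have hnn : ∀ i k, 0 ≤ᵐ[volume.restrict G.period] fun t => w k t * q i t := by
    intro i k
    filter_upwards [h.1.q_nonneg i, ae_mem_period] with t ht hmem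
    exact mul_nonneg (h.1.w_nonneg k t hmem) ht
  have hzero : ∀ i, G.Leads i j → ∀ᵐ t ∂volume.restrict G.period, w j t * q i t = 0 := by
    intro i hij
    have hle : ∫ t in G.period, w j t * q i t ≤ 0 := by
      refine le_trans ?_ h.queueCost_nonpos
      refine (Finset.single_le_sum (f := fun k => ∫ t in G.period, w k t * q i t)
        (fun k _ => integral_nonneg_of_ae (hnn i k))
        (show j ∈ G.down i by simpa using hij)).trans ?_
      exact Finset.single_le_sum
        (f := fun i => ∑ k ∈ G.down i, ∫ t in G.period, w k t * q i t)
        (fun i _ => Finset.sum_nonneg fun k _ => integral_nonneg_of_ae (hnn i k))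
        (Finset.mem_univ i)
    exact (integral_eq_zero_iff_of_nonneg_ae (hnn i j) (h.1.integrable_w_mul i j)).1
      (le_antisymm hle (integral_nonneg_of_ae (hnn i j)))
  have hzero' : ∀ᵐ t ∂volume.restrict G.period, ∀ i, G.Leads i j → w j t * q i t = 0 := by
    rw [ae_all_iff]
    intro i
    by_cases hij : G.Leads i j
    · filter_upwards [hzero i hij] with t ht _ using ht
    · exact ae_of_all _ fun t h0 => absurd h0 hij
  -- a queue discharges at a positive rate, so it would cause queueing costs
  have hae : w j =ᵐ[volume.restrict G.period] fun _ => 0 := by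
    filter_upwards [hzero', h.1.queue_pos j, h.1.sigmaDot_pos j, ae_mem_period]
      with t h0 hpos hσ hmem
    by_contra hne
    have hw : 0 < w j t := (h.1.w_nonneg j t hmem).lt_of_ne' hne
    have hX : ∑ i ∈ G.up j, q i t = 0 := Finset.sum_eq_zero fun i hi =>
      (mul_eq_zero.1 (h0 i (by simpa using hi))).resolve_left hw.ne'
    have := hpos hw
    rw [hX] at this
    exact (mul_pos hj hσ).ne this
  exact Measure.eqOn_Icc_of_ae_eq volume G.a_lt_b.ne hae (h.1.continuousOn_w j) continuousOn_const

lemma isAdmissible (h : G.IsOptimal q w) : G.IsAdmissible q where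
  integrable := h.1.q_integrable
  nonneg := h.1.q_nonneg
  capacity i := by
    rcases (G.μ_nonneg i).eq_or_lt with hi | hi
    · filter_upwards [h.1.flow_le i] with t ht
      simpa [← hi] using ht
    · have hIoo : ∀ᵐ t ∂volume.restrict G.period, t ∈ Ioo G.a G.b := by
        rw [period, ← restrict_Ioo_eq_restrict_Icc]
        exact ae_restrict_mem measurableSet_Ioo
      filter_upwards [h.1.flow_le i, hIoo] with t ht hmem
      have hσ : G.sigmaDot w i t = 1 := by
        rw [sigmaDot, Finset.sum_eq_zero, sub_zero]
        intro j hj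
        rw [Finset.mem_erase, mem_down] at hj
        have hev : w j =ᶠ[nhds t] fun _ => 0 := by
          filter_upwards [Ioo_mem_nhds hmem.1 hmem.2] with s hs
          exact h.w_eq_zero (hi.trans_le (μ_le_of_leads hj.2)) s (Ioo_subset_Icc_self hs)
        rw [hev.deriv_eq, deriv_const]
      rwa [hσ, mul_one] at ht

lemma isScheduleOptimal (h : G.IsOptimal q w) : G.IsScheduleOptimal q := by
  refine ⟨h.isAdmissible, fun q' hq' hdem => ?_⟩
  have hf := hq'.isFeasible fun i => (hdem i).trans (h.1.demand i)
  have h1 := h.2 _ _ hf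
  have h2 : 0 ≤ ∑ i, ∑ j ∈ G.down i, ∫ t in G.period, w j t * q i t := by
    refine Finset.sum_nonneg fun i _ => Finset.sum_nonneg fun j _ => integral_nonneg_of_ae ?_
    filter_upwards [h.1.q_nonneg i, ae_mem_period] with t ht hmem
    exact mul_nonneg (h.1.w_nonneg j t hmem) ht
  rw [h.1.cost_eq, hf.cost_eq] at h1
  simp only [zero_mul, integral_zero, Finset.sum_const_zero, add_zero] at h1
  linarith

end IsOptimal
end TreeNetwork

theorem corollary3 {N : ℕ} (G : TreeNetwork N) (q w : Fin N → ℝ → ℝ) (hopt : G.IsOptimal q w) :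
    ∃ (ρ : Fin N → ℝ) (p : Fin N → ℝ → ℝ), G.OptimalityConditions q ρ p :=
  hopt.isScheduleOptimal.exists_optimalityConditions hopt.1.demand
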